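/- Let $(H,G)$ be a crossed module of topological groups: topological groups $G,H$, a continuous homomorphism $t\colon G\to H$ and an action $\alpha$ of $H$ on $G$ by automorphisms (with $H\times G\to G$ continuous) such that $t(\alpha(h)(g))=h\,t(g)\,h^{-1}$ and $\alpha(t(g))(k)=gkg^{-1}$. Give $t(G)\subset H$ the subspace topology and $H/t(G)$ the quotient topology, and assume that the surjections $G\to t(G)$ and $H\to H/t(G)$ admit continuous local sections (near every point of the target). An $(H,G)$ bibundle over a space $M$ is a locally trivial right principal $G$-bundle $\pi\colon P\to M$ with a continuous structure map $\psi\colon P\to H$ such that $\psi(pg)=\psi(p)t(g)$. An isomorphism of bibundles over $M$ is a $G$-equivariant homeomorphism over $M$ that commutes with the structure maps, and $\pi_0\mathrm{Bibun}_{(H,G)}(M)$ is the set of isomorphism classes. The type map $M\to H/t(G)$ of $P$ sends $\pi(p)$ to the coset $[\psi(p)]$. Let $EG\to BG$ be a universal $G$-bundle, that is, a locally trivial right principal $G$-bundle with contractible total space. Let $G$ act on $EG\times H$ by $(e,h)g=(eg,h\,t(g))$, and let $EG\times_G H$ be the quotient, regarded as a space over $H/t(G)$ by $\Phi([e,h])=[h]$.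 With the projection to $H$ as structure map, $EG\times H\to EG\times_G H$ is an $(H,G)$ bibundle. For a space $M$, let $[M,EG\times_G H]_{H/t(G)}$ be the set of all continuous maps $f\colon M\to EG\times_G H$ modulo homotopies $h_s$ over $H/t(G)$, i.e. with $\Phi\circ h_s$ independent of $s$; equivalently, the disjoint union over all continuous $\varphi\colon M\to H/t(G)$ of the sets of homotopy classes over $H/t(G)$ of maps $(M,\varphi)\to (EG\times_G H,\Phi)$ over $H/t(G)$. Theorem. The bibundle $EG\times H\to EG\times_G H$ is classifying: let $M$ be a paracompact Hausdorff space. Every $(H,G)$ bibundle $P\to M$ admits a continuous $G$-equivariant map $\hat f\colon P\to EG$, and there is a bijection $$\pi_0\mathrm{Bibun}_{(H,G)}(M)\;\cong\;[M,EG\times_G H]_{H/t(G)}$$ which, for every bibundle $P$ and every choice of $\hat f$, sends the isomorphism class of $P$ to the class of the continuous map $\Gamma\colon M\to EG\times_G H$ determined by $\Gamma(\pi(p))=[\hat f(p),\psi(p)]$. The map $M\to H/t(G)$ underlying the image of $[P]$ is the type map of $P$, and the inverse of the bijection sends the class of $f$ to the isomorphism class of the pullback $f^*(EG\times H)$. 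-/

import Mathlib

open scoped RightActions

universe u

/-- A crossed module of topological groups `G --t--> H --α--> Aut(G)`. -/
structure TopCrossedModule (G H : Type u) [Group G] [TopologicalSpace G] [Group H]
    [TopologicalSpace H] where
  t : G →ₜ* H
  α : H →* MulAut G
  /-- The action of `H` on `G` is (jointly) continuous. -/
  continuous_α : Continuous fun p : H × G => α p.1 p.2
  t_α : ∀ h g, t (α h g) = h * t g * h⁻¹
  α_t : ∀ g k, α (t g) k = g * k * g⁻¹

/-- The subgroup `t(G)` of `H`, with its subspace topology. -/
abbrev TopCrossedModule.tG {G H : Type u} [Group G] [TopologicalSpace G] [Group H]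
    [TopologicalSpace H] (X : TopCrossedModule G H) : Subgroup H :=
  X.t.toMonoidHom.range

/-- The map `f` admits continuous local sections: every point of the target has an open
neighbourhood over which `f` has a continuous section. -/
def HasLocalSections {A B : Type u} [TopologicalSpace A] [TopologicalSpace B] (f : A → B) : Prop :=
  ∀ b : B, ∃ U : Set B, IsOpen U ∧ b ∈ U ∧ ∃ s : C(U, A), ∀ x : U, f (s x) = x

/-- A (right, locally trivial) principal `G`-bundle over `M`. The right action of `g` on `p` is
written `p <• g`. -/
structure PrincipalBundle (G : Type u) [Group G] [TopologicalSpace G]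
    (M : Type u) [TopologicalSpace M] where
  Total : Type u
  [topology : TopologicalSpace Total]
  [action : MulAction Gᵐᵒᵖ Total]
  [continuous_action : ContinuousSMul Gᵐᵒᵖ Total]
  proj : C(Total, M)
  proj_act : ∀ (p : Total) (g : G), proj (p <• g) = proj p
  locally_trivial : ∀ m : M, ∃ U : Set M, IsOpen U ∧ m ∈ U ∧
    ∃ φ : U × G ≃ₜ (proj ⁻¹' U : Set Total),
      (∀ x g, proj (φ (x, g)) = x) ∧
      (∀ x g k, (φ (x, g * k) : Total) = (φ (x, g) : Total) <• k)

attribute [instance] PrincipalBundle.topology PrincipalBundle.action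
  PrincipalBundle.continuous_action

/-- A principal `G`-bundle `EG → BG` is universal if its total space is contractible. -/
def PrincipalBundle.IsUniversal {G : Type u} [Group G] [TopologicalSpace G]
    {M : Type u} [TopologicalSpace M] (E : PrincipalBundle G M) : Prop :=
  ContractibleSpace E.Total

/-- The pullback `f^*P = N ×_M P` of a principal bundle. -/
def PrincipalBundle.pullback {G : Type u} [Group G] [TopologicalSpace G]
    {M N : Type u} [TopologicalSpace M] [TopologicalSpace N]
    (P : PrincipalBundle G M) (f : C(N, M)) : PrincipalBundle G N where
  Total := {x : N × P.Total // f x.1 = P.proj x.2}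
  action :=
    { smul := fun g x => ⟨(x.1.1, g • x.1.2), by
        rw [x.2]; exact (P.proj_act x.1.2 g.unop).symm⟩
      one_smul := fun x => Subtype.ext (Prod.ext rfl (one_smul _ _))
      mul_smul := fun g k x => Subtype.ext (Prod.ext rfl (mul_smul g k x.1.2)) }
  continuous_action := by
    let _ : SMul Gᵐᵒᵖ {x : N × P.Total // f x.1 = P.proj x.2} :=
      ⟨fun g x => ⟨(x.1.1, g • x.1.2), by
        rw [x.2]; exact (P.proj_act x.1.2 g.unop).symm⟩⟩
    exact ⟨Continuous.subtype_mk
      (((continuous_fst.comp continuous_subtype_val).comp continuous_snd).prodMk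
        (continuous_fst.smul ((continuous_snd.comp continuous_subtype_val).comp continuous_snd))) _⟩
  proj := ⟨fun x => x.1.1, by fun_prop⟩
  proj_act := fun _ _ => rfl
  locally_trivial := fun n => by
    obtain ⟨U, hU, hn, φ, hφ, hφ'⟩ := P.locally_trivial (f n)
    refine ⟨f ⁻¹' U, hU.preimage f.continuous, hn,
      { toFun := fun y => ⟨⟨(y.1.1, (φ (⟨f y.1.1, y.1.2⟩, y.2)).1),
            (hφ ⟨f y.1.1, y.1.2⟩ y.2).symm⟩, y.1.2⟩
        invFun := fun z => (⟨z.1.1.1, z.2⟩, (φ.symm ⟨z.1.1.2, by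
          have h := z.2
          change f z.1.1.1 ∈ U at h
          rw [z.1.2] at h
          exact h⟩).2)
        left_inv := ?_
        right_inv := ?_
        continuous_toFun := ?_
        continuous_invFun := ?_ }, fun _ _ => rfl, ?_⟩
    · rintro ⟨⟨x, hx⟩, g⟩
      refine Prod.ext rfl ?_
      simp
    · rintro ⟨⟨⟨x, p⟩, hxp⟩, hx⟩
      refine Subtype.ext (Subtype.ext (Prod.ext rfl ?_))
      have hp : p ∈ P.proj ⁻¹' U := by
        change P.proj p ∈ U
        have h : f x ∈ U := hx
        have h' : f x = P.proj p := hxp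
        rwa [h'] at h
      have h1 : (φ.symm ⟨p, hp⟩).1 = ⟨f x, hx⟩ := by
        apply Subtype.ext
        have := hφ (φ.symm ⟨p, hp⟩).1 (φ.symm ⟨p, hp⟩).2
        simp only [Prod.mk.eta, Homeomorph.apply_symm_apply] at this
        rw [← this]
        exact hxp.symm
      change ((φ (⟨f x, hx⟩, (φ.symm ⟨p, hp⟩).2)) : P.Total) = p
      rw [← h1]
      simp
    · fun_prop
    · fun_prop
    · intro x g k
      exact Subtype.ext (Prod.ext rfl (hφ' _ _ _))

/-- An `(H, G)` bibundle over `M`: a principal `G`-bundle with a continuous structure map `ψ` to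
`H` which is equivariant, `ψ(pg) = ψ(p) t(g)`. -/
structure Bibundle {G H : Type u} [Group G] [TopologicalSpace G] [Group H] [TopologicalSpace H]
    (X : TopCrossedModule G H) (M : Type u) [TopologicalSpace M] extends PrincipalBundle G M where
  ψ : C(Total, H)
  ψ_act : ∀ (p : Total) (g : G), ψ (p <• g) = ψ p * X.t g

section

variable {G H : Type u} [Group G] [TopologicalSpace G] [Group H] [TopologicalSpace H]
  {X : TopCrossedModule G H} {M N : Type u} [TopologicalSpace M] [TopologicalSpace N]

/-- The pullback of a bibundle, with structure map `(n, p) ↦ ψ(p)`. -/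
def Bibundle.pullback (P : Bibundle X M) (f : C(N, M)) : Bibundle X N where
  toPrincipalBundle := P.toPrincipalBundle.pullback f
  ψ := ⟨fun x => P.ψ x.1.2,
    P.ψ.continuous.comp (continuous_snd.comp continuous_subtype_val)⟩
  ψ_act := fun p g => P.ψ_act p.1.2 g

/-- Isomorphism of bibundles over `M` (covering the identity of `M`). -/
def Bibundle.Isomorphic (P Q : Bibundle X M) : Prop :=
  ∃ e : P.Total ≃ₜ Q.Total, (∀ p, Q.proj (e p) = P.proj p) ∧
    (∀ (p : P.Total) (g : G), e (p <• g) = e p <• g) ∧ (∀ p, Q.ψ (e p) = P.ψ p)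

variable (X M) in
/-- Isomorphism of bibundles over `M` is an equivalence relation. -/
def Bibundle.setoid : Setoid (Bibundle X M) where
  r := Bibundle.Isomorphic
  iseqv :=
    { refl := fun P => ⟨Homeomorph.refl _, fun _ => rfl, fun _ _ => rfl, fun _ => rfl⟩
      symm := by
        rintro P Q ⟨e, h1, h2, h3⟩
        refine ⟨e.symm, fun q => ?_, fun q g => ?_, fun q => ?_⟩
        · rw [← h1, e.apply_symm_apply]
        · apply e.injective
          rw [h2, e.apply_symm_apply, e.apply_symm_apply]
        · rw [← h3, e.apply_symm_apply]
      trans := by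
        rintro P Q R ⟨e, h1, h2, h3⟩ ⟨e', h1', h2', h3'⟩
        refine ⟨e.trans e', fun p => ?_, fun p g => ?_, fun p => ?_⟩
        · simp [h1, h1']
        · simp [h2, h2']
        · simp [h3, h3'] }

variable (X M) in
/-- `π₀ Bibun_{(H,G)}(M)`: the set of isomorphism classes of `(H, G)` bibundles over `M`. -/
def Pi0Bibun : Type (u + 1) := Quotient (Bibundle.setoid X M)

/-- The isomorphism class `[P]`. -/
def Bibundle.isoClass (P : Bibundle X M) : Pi0Bibun X M := Quotient.mk (Bibundle.setoid X M) P

/-- The space `P × H`; it carries the right `G`-action `(p, h)g = (pg, h t(g))`. -/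
def PrincipalBundle.TwistedProd (P : PrincipalBundle G M) (_X : TopCrossedModule G H) : Type u :=
  P.Total × H

instance (P : PrincipalBundle G M) (X : TopCrossedModule G H) :
    TopologicalSpace (P.TwistedProd X) :=
  inferInstanceAs (TopologicalSpace (P.Total × H))

instance (P : PrincipalBundle G M) (X : TopCrossedModule G H) :
    MulAction Gᵐᵒᵖ (P.TwistedProd X) where
  smul g y := (y.1 <• g.unop, y.2 * X.t g.unop)
  one_smul y := Prod.ext (one_smul _ y.1) (by
    change y.2 * X.t 1 = y.2
    simp)
  mul_smul g k y := Prod.ext (mul_smul g k y.1) (by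
    change y.2 * X.t (k.unop * g.unop) = y.2 * X.t k.unop * X.t g.unop
    simp [mul_assoc])

/-- The space `P ×_G H = (P × H)/G`, with the quotient topology. -/
def PrincipalBundle.Assoc (P : PrincipalBundle G M) (X : TopCrossedModule G H) : Type u :=
  MulAction.orbitRel.Quotient Gᵐᵒᵖ (P.TwistedProd X)

instance (P : PrincipalBundle G M) (X : TopCrossedModule G H) : TopologicalSpace (P.Assoc X) :=
  inferInstanceAs (TopologicalSpace (Quotient (MulAction.orbitRel Gᵐᵒᵖ (P.TwistedProd X))))

/-- The point `[p, h]` of `P ×_G H`. -/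
def PrincipalBundle.assocMk (P : PrincipalBundle G M) (X : TopCrossedModule G H)
    (p : P.Total) (h : H) : P.Assoc X :=
  Quotient.mk (MulAction.orbitRel Gᵐᵒᵖ (P.TwistedProd X)) ((p, h) : P.Total × H)

/-- `[pg, h t(g)] = [p, h]`. -/
theorem PrincipalBundle.assocMk_act (P : PrincipalBundle G M) (X : TopCrossedModule G H)
    (p : P.Total) (h : H) (g : G) : P.assocMk X (p <• g) (h * X.t g) = P.assocMk X p h :=
  Quotient.sound (s := MulAction.orbitRel Gᵐᵒᵖ (P.TwistedProd X)) ⟨MulOpposite.op g, rfl⟩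

theorem PrincipalBundle.assocMk_eq (P : PrincipalBundle G M) (X : TopCrossedModule G H)
    {p p' : P.Total} {h h' : H} (e : P.assocMk X p h = P.assocMk X p' h') :
    ∃ g : G, p' <• g = p ∧ h' * X.t g = h := by
  obtain ⟨g, hg⟩ := Quotient.exact (s := MulAction.orbitRel Gᵐᵒᵖ (P.TwistedProd X)) e
  exact ⟨g.unop, congrArg Prod.fst hg, congrArg Prod.snd hg⟩

theorem PrincipalBundle.isQuotientMap_assocMk (P : PrincipalBundle G M)
    (X : TopCrossedModule G H) :
    Topology.IsQuotientMap fun y : P.Total × H => P.assocMk X y.1 y.2 :=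
  isQuotientMap_quot_mk

/-- The canonical map `P ×_G H → M`, `[p, h] ↦ π(p)`. -/
def PrincipalBundle.assocProj (P : PrincipalBundle G M) (X : TopCrossedModule G H) :
    C(P.Assoc X, M) where
  toFun := Quotient.lift (s := MulAction.orbitRel Gᵐᵒᵖ (P.TwistedProd X))
    (fun y : P.Total × H => P.proj y.1) (by
      rintro _ y ⟨g, rfl⟩
      exact P.proj_act y.1 g.unop)
  continuous_toFun := Continuous.quotient_lift
    (P.proj.continuous.comp (continuous_fst (X := P.Total) (Y := H))) _

/-- The map `Φ : P ×_G H → H/t(G)`, `[p, h] ↦ [h]`. -/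
def PrincipalBundle.assocType (P : PrincipalBundle G M) (X : TopCrossedModule G H) :
    C(P.Assoc X, H ⧸ X.tG) where
  toFun := Quotient.lift (s := MulAction.orbitRel Gᵐᵒᵖ (P.TwistedProd X))
    (fun y : P.Total × H => (QuotientGroup.mk y.2 : H ⧸ X.tG)) (by
      rintro _ y ⟨g, rfl⟩
      refine (QuotientGroup.eq.2 ?_).symm
      exact ⟨g.unop, by
        change X.t g.unop = y.2⁻¹ * (y.2 * X.t g.unop)
        simp⟩)
  continuous_toFun := Continuous.quotient_lift
    (continuous_quotient_mk'.comp (continuous_snd (X := P.Total) (Y := H))) _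

/-- The translation part of a trivialization is equivariant. -/
theorem PrincipalBundle.trivialization_symm_act (P : PrincipalBundle G M) {U : Set M}
    (φ : U × G ≃ₜ (P.proj ⁻¹' U : Set P.Total))
    (hφ' : ∀ x g k, (φ (x, g * k) : P.Total) = (φ (x, g) : P.Total) <• k)
    (p : P.Total) (hp : p ∈ P.proj ⁻¹' U) (g : G) (hpg : p <• g ∈ P.proj ⁻¹' U) :
    (φ.symm ⟨p <• g, hpg⟩).2 = (φ.symm ⟨p, hp⟩).2 * g := by
  have h : φ.symm ⟨p <• g, hpg⟩ = ((φ.symm ⟨p, hp⟩).1, (φ.symm ⟨p, hp⟩).2 * g) := by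
    rw [Homeomorph.symm_apply_eq]
    apply Subtype.ext
    rw [hφ']
    simp
  rw [h]

/-- Local triviality of `P × H → P ×_G H`. -/
theorem PrincipalBundle.assoc_locally_trivial [IsTopologicalGroup G] [IsTopologicalGroup H]
    (P : PrincipalBundle G M) (X : TopCrossedModule G H) (b : P.Assoc X) :
    ∃ V : Set (P.Assoc X), IsOpen V ∧ b ∈ V ∧
      ∃ φ : V × G ≃ₜ ((fun y : P.Total × H => P.assocMk X y.1 y.2) ⁻¹' V : Set (P.Total × H)),
        (∀ x g, P.assocMk X (φ (x, g)).1.1 (φ (x, g)).1.2 = x) ∧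
        (∀ x g k, (φ (x, g * k)).1 = ((φ (x, g)).1.1 <• k, (φ (x, g)).1.2 * X.t k)) := by
  obtain ⟨U, hU, hb, φ, -, hφ'⟩ := P.locally_trivial (P.assocProj X b)
  let V : Set (P.Assoc X) := P.assocProj X ⁻¹' U
  let q : P.Total × H → P.Assoc X := fun y => P.assocMk X y.1 y.2
  have hV : IsOpen V := hU.preimage (P.assocProj X).continuous
  have hq : Topology.IsQuotientMap q := P.isQuotientMap_assocMk X
  have hqV := hq.restrictPreimage_isOpen hV
  have ht : Continuous X.t := X.t.continuous_toFun
  -- the translation part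
  let κ : q ⁻¹' V → G := fun y => (φ.symm ⟨y.1.1, y.2⟩).2
  have hκ : Continuous κ := by fun_prop
  have hκact : ∀ (y y' : q ⁻¹' V) (g : G), y'.1 = (y.1.1 <• g, y.1.2 * X.t g) →
      κ y' = κ y * g := by
    rintro ⟨⟨p, h⟩, hy⟩ ⟨⟨p', h'⟩, hy'⟩ g e
    obtain ⟨rfl, rfl⟩ := Prod.mk.inj e
    exact P.trivialization_symm_act φ hφ' p hy g hy'
  -- the local section, before passing to the quotient
  let r : C(q ⁻¹' V, (q ⁻¹' V : Set (P.Total × H))) :=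
    ⟨fun y => ⟨(y.1.1 <• (κ y)⁻¹, y.1.2 * X.t (κ y)⁻¹), by
      change q _ ∈ V
      have h : q y.1 ∈ V := y.2
      simpa only [q, P.assocMk_act X] using h⟩, by
      refine Continuous.subtype_mk (Continuous.prodMk ?_ ?_) _
      · exact (MulOpposite.continuous_op.comp hκ.inv).smul
          (continuous_fst.comp continuous_subtype_val)
      · exact (continuous_snd.comp continuous_subtype_val).mul (ht.comp hκ.inv)⟩
  have hr : ∀ y y' : q ⁻¹' V, V.restrictPreimage q y = V.restrictPreimage q y' → r y = r y' := by
    intro y y' e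
    obtain ⟨g, h1, h2⟩ := P.assocMk_eq X (congrArg Subtype.val e)
    have h3 := hκact y' y g (Prod.ext h1.symm h2.symm)
    apply Subtype.ext
    change ((y.1.1 <• (κ y)⁻¹, y.1.2 * X.t (κ y)⁻¹) : P.Total × H) =
      (y'.1.1 <• (κ y')⁻¹, y'.1.2 * X.t (κ y')⁻¹)
    rw [h3, ← h1, ← h2]
    refine Prod.ext ?_ ?_
    · simp [smul_smul, ← MulOpposite.op_mul]
    · simp [mul_assoc]
  let σ : C(V, (q ⁻¹' V : Set (P.Total × H))) := hqV.lift (f := ⟨_, hqV.continuous⟩) r hr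
  have hσ : ∀ y : q ⁻¹' V, σ (V.restrictPreimage q y) = r y := fun y =>
    DFunLike.congr_fun (hqV.lift_comp (f := ⟨_, hqV.continuous⟩) r hr) y
  have hqσ : ∀ v : V, q (σ v).1 = v := by
    intro v
    obtain ⟨y, rfl⟩ := hqV.surjective v
    rw [hσ]
    exact P.assocMk_act X _ _ _
  have hκσ : ∀ v : V, κ (σ v) = 1 := by
    intro v
    obtain ⟨y, rfl⟩ := hqV.surjective v
    rw [hσ, hκact y (r y) (κ y)⁻¹ rfl, mul_inv_cancel]
  refine ⟨V, hV, hb,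
    { toFun := fun z => ⟨((σ z.1).1.1 <• z.2, (σ z.1).1.2 * X.t z.2), by
        change q _ ∈ V
        have h : q (σ z.1).1 ∈ V := (σ z.1).2
        simpa only [q, P.assocMk_act X] using h⟩
      invFun := fun y => (V.restrictPreimage q y, κ y)
      left_inv := ?_
      right_inv := ?_
      continuous_toFun := ?_
      continuous_invFun := hqV.continuous.prodMk hκ }, ?_, ?_⟩
  · rintro ⟨v, g⟩
    refine Prod.ext (Subtype.ext ?_) ?_
    · exact (P.assocMk_act X _ _ _).trans (hqσ v)
    · refine (hκact (σ v) _ g rfl).trans ?_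
      rw [hκσ, one_mul]
  · intro y
    apply Subtype.ext
    change (((σ (V.restrictPreimage q y)).1.1 <• κ y,
      (σ (V.restrictPreimage q y)).1.2 * X.t (κ y)) : P.Total × H) = y.1
    rw [hσ]
    change ((y.1.1 <• (κ y)⁻¹ <• κ y, y.1.2 * X.t (κ y)⁻¹ * X.t (κ y)) : P.Total × H) = y.1
    refine Prod.ext ?_ ?_
    · simp
    · simp
  · refine Continuous.subtype_mk (Continuous.prodMk ?_ ?_) _
    · exact (MulOpposite.continuous_op.comp continuous_snd).smul
        (continuous_fst.comp (continuous_subtype_val.comp (σ.continuous.comp continuous_fst)))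
    · exact (continuous_snd.comp (continuous_subtype_val.comp
        (σ.continuous.comp continuous_fst))).mul (ht.comp continuous_snd)
  · intro v g
    exact (P.assocMk_act X _ _ _).trans (hqσ v)
  · intro v g k
    change (((σ v).1.1 <• (g * k), (σ v).1.2 * X.t (g * k)) : P.Total × H) =
      ((σ v).1.1 <• g <• k, (σ v).1.2 * X.t g * X.t k)
    refine Prod.ext ?_ ?_
    · simp [mul_smul]
    · simp [mul_assoc]

/-- The `(H, G)` bibundle `P × H → P ×_G H`, `(p, h) ↦ [p, h]`, with right action
`(p, h)g = (pg, h t(g))` and with structure map the projection to `H`. -/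
def PrincipalBundle.assocBibundle [IsTopologicalGroup G] [IsTopologicalGroup H]
    (P : PrincipalBundle G M) (X : TopCrossedModule G H) : Bibundle X (P.Assoc X) where
  Total := P.TwistedProd X
  continuous_action := ⟨by
    change Continuous fun z : Gᵐᵒᵖ × (P.Total × H) =>
      ((z.1 • z.2.1, z.2.2 * X.t z.1.unop) : P.Total × H)
    have h2 : Continuous fun z : Gᵐᵒᵖ × (P.Total × H) => X.t z.1.unop :=
      X.t.continuous_toFun.comp (MulOpposite.continuous_unop.comp continuous_fst)
    fun_prop⟩
  proj := ⟨fun y => P.assocMk X y.1 y.2, (P.isQuotientMap_assocMk X).continuous⟩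
  proj_act y g := P.assocMk_act X y.1 y.2 g
  ψ := ⟨fun y => y.2, continuous_snd (X := P.Total) (Y := H)⟩
  ψ_act _ _ := rfl
  locally_trivial b := P.assoc_locally_trivial X b

end

/-- Maps over `B` from `(X, p)` to `(Y, q)`. -/
def MapsOver {X Y B : Type u} [TopologicalSpace X] [TopologicalSpace Y] [TopologicalSpace B]
    (p : C(X, B)) (q : C(Y, B)) : Type u :=
  {f : C(X, Y) // q.comp f = p}

/-- Homotopy over `B` of maps over `B`. -/
def MapsOver.setoid {X Y B : Type u} [TopologicalSpace X] [TopologicalSpace Y]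
    [TopologicalSpace B] (p : C(X, B)) (q : C(Y, B)) : Setoid (MapsOver p q) where
  r f₀ f₁ := ∃ h : f₀.1.Homotopy f₁.1, ∀ (s : unitInterval) (x : X), q (h (s, x)) = p x
  iseqv :=
    { refl := fun f => ⟨ContinuousMap.Homotopy.refl f.1, fun _ x => DFunLike.congr_fun f.2 x⟩
      symm := by
        rintro f₀ f₁ ⟨h, hh⟩
        exact ⟨h.symm, fun s x => by rw [ContinuousMap.Homotopy.symm_apply]; exact hh _ _⟩
      trans := by
        rintro f₀ f₁ f₂ ⟨h, hh⟩ ⟨k, hk⟩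
        refine ⟨h.trans k, fun s x => ?_⟩
        rw [ContinuousMap.Homotopy.trans_apply]
        split_ifs
        · exact hh _ _
        · exact hk _ _ }

/-- The set `[X, Y]_B` of homotopy classes over `B` of maps over `B` from `(X, p)` to `(Y, q)`. -/
def HomotopyClassesOver {X Y B : Type u} [TopologicalSpace X] [TopologicalSpace Y]
    [TopologicalSpace B] (p : C(X, B)) (q : C(Y, B)) : Type u :=
  Quotient (MapsOver.setoid p q)

/-- `[M, Y]_B` for a space `M` that comes without a given map to `B`: all continuous maps
`p : M → B` are allowed, so that an element is such a map `p` together with a homotopy class over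
`B` of maps `(M, p) → (Y, q)`. Equivalently, it is the set of all continuous maps `M → Y` modulo
those homotopies whose composite with `q` is constant in time. -/
def AllHomotopyClassesOver (M : Type u) {Y B : Type u} [TopologicalSpace M] [TopologicalSpace Y]
    [TopologicalSpace B] (q : C(Y, B)) : Type u :=
  Σ p : C(M, B), HomotopyClassesOver p q

/-- The class in `[M, Y]_B` of a continuous map `f : M → Y`; it lies over `q ∘ f`. -/
def homotopyClassOver {M Y B : Type u} [TopologicalSpace M] [TopologicalSpace Y]
    [TopologicalSpace B] (q : C(Y, B)) (f : C(M, Y)) : AllHomotopyClassesOver M q :=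
  ⟨q.comp f, Quotient.mk (MapsOver.setoid (q.comp f) q) ⟨f, rfl⟩⟩

/-! Two facts carry the theorem. The first is the universal property of a contractible $G$-space
$Y$: a principal bundle over a paracompact Hausdorff base has an equivariant map to $Y$, unique up
to equivariant homotopy. Over a trivializing set a contraction of $Y$ transports to an equivariant
deformation. Scaling its time by bump functions and composing the results in a fixed order gives a
global deformation whose end forgets its start (`exists_equivariant_deformation`). Existence and
uniqueness both follow from it.

The second fact is homotopy invariance: maps homotopic with constant type pull a bibundle back to
isomorphic bibundles. Equivalently, a bibundle over $[0,1]\times M$ whose type does not depend on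
time has a $\psi$-preserving transport to time $1$ (`HasConstantType.exists_transport`). Constancy
of the type says that along a local section $\psi$ varies in time by elements of $t(G)$. Local
sections of $G\to t(G)$ lift this variation to $G$, and translating by the inverse lift makes $\psi$
constant in time. Compactness of $[0,1]$ extends such sections to all times, and the same ordered
composition of bump-controlled moves makes the transport global.

Given these, $[P]\mapsto[\Gamma]$ is well defined by the first fact. It is surjective because
$f^*(EG\times H)$ is classified by $f$. It is injective because $p\mapsto(\pi(p),\hat f(p),\psi(p))$
identifies $P$ with $\Gamma^*(EG\times H)$, whose isomorphism class depends only on $[\Gamma]$ by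
the second fact. -/

section

open Set Filter Topology

/-! ### Local sections, translation function and isomorphisms of principal bundles -/

namespace PrincipalBundle

section

variable {G : Type u} [Group G] [TopologicalSpace G] {M : Type u} [TopologicalSpace M]
  (P : PrincipalBundle G M)

/-- Near every point of the base there is a local section `σ`, and the translation `κ` from it. -/
theorem exists_local_section (m : M) : ∃ U : Set M, IsOpen U ∧ m ∈ U ∧
    ∃ (σ : M → P.Total) (κ : P.Total → G), ContinuousOn σ U ∧ ContinuousOn κ (P.proj ⁻¹' U) ∧
      (∀ x ∈ U, P.proj (σ x) = x) ∧ (∀ p, P.proj p ∈ U → σ (P.proj p) <• κ p = p) ∧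
      (∀ p g, P.proj p ∈ U → κ (p <• g) = κ p * g) := by
  classical
  obtain ⟨U, hU, hm, φ, hφ, hφ'⟩ := P.locally_trivial m
  -- An arbitrary value for `σ` off `U`, so that `σ` and `κ` are total and continuity becomes
  -- `ContinuousOn`.
  have p₀ : P.Total := (φ (⟨m, hm⟩, 1)).1
  let σ : M → P.Total := fun x => if h : x ∈ U then (φ (⟨x, h⟩, 1)).1 else p₀
  let κ : P.Total → G := fun p => if h : P.proj p ∈ U then (φ.symm ⟨p, h⟩).2 else 1
  have hσ : ∀ x (h : x ∈ U), σ x = (φ (⟨x, h⟩, 1)).1 := fun x h => dif_pos h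
  have hκ : ∀ p (h : P.proj p ∈ U), κ p = (φ.symm ⟨p, h⟩).2 := fun p h => dif_pos h
  refine ⟨U, hU, hm, σ, κ, ?_, ?_, ?_, ?_, ?_⟩
  · rw [continuousOn_iff_continuous_domRestrict]
    have : U.domRestrict σ = fun x => (φ (x, 1)).1 := funext fun x => hσ x x.2
    rw [this]
    fun_prop
  · rw [continuousOn_iff_continuous_domRestrict]
    have : (P.proj ⁻¹' U).domRestrict κ = fun x => (φ.symm x).2 := funext fun x => hκ x x.2
    rw [this]
    fun_prop
  · intro x hx
    rw [hσ x hx, hφ]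
  · intro p hp
    rw [hσ _ hp, hκ p hp, ← hφ', one_mul]
    have h := hφ (φ.symm ⟨p, hp⟩).1 (φ.symm ⟨p, hp⟩).2
    simp only [Prod.mk.eta, Homeomorph.apply_symm_apply] at h
    have h' : (⟨P.proj p, hp⟩ : U) = (φ.symm ⟨p, hp⟩).1 := Subtype.ext h
    rw [h', Prod.mk.eta, Homeomorph.apply_symm_apply]
  · intro p g hp
    have hpg : P.proj (p <• g) ∈ U := by rwa [P.proj_act]
    rw [hκ p hp, hκ _ hpg]
    exact P.trivialization_symm_act φ hφ' p hp g hpg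

theorem act_inv_mul {p q s : P.Total} {g k : G} (hp : s <• g = p) (hq : s <• k = q) :
    p <• (g⁻¹ * k) = q := by
  subst hp hq
  simp [smul_smul]

theorem act_injective {p : P.Total} {g k : G} (h : p <• g = p <• k) : g = k := by
  obtain ⟨U, -, hm, σ, κ, -, -, -, -, hκ⟩ := P.exists_local_section (P.proj p)
  have h' := congrArg κ h
  rwa [hκ _ _ hm, hκ _ _ hm, mul_right_inj] at h'

theorem exists_act_eq {p q : P.Total} (h : P.proj p = P.proj q) : ∃ g : G, p <• g = q := by
  obtain ⟨U, -, hm, σ, κ, -, -, -, hσ, -⟩ := P.exists_local_section (P.proj p)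
  refine ⟨(κ p)⁻¹ * κ q, ?_⟩
  have hp := hσ p hm
  have hq := hσ q (h ▸ hm)
  rw [← h] at hq
  exact P.act_inv_mul hp hq

open Classical in
/-- The element of `G` that translates `p` to `q`, for `p` and `q` in the same fibre. -/
noncomputable def div (p q : P.Total) : G :=
  if h : ∃ g : G, p <• g = q then h.choose else 1

theorem act_div {p q : P.Total} (h : P.proj p = P.proj q) : p <• P.div p q = q := by
  have h' := P.exists_act_eq h
  rw [div, dif_pos h']
  exact h'.choose_spec

theorem div_eq {p q : P.Total} {g : G} (h : p <• g = q) : P.div p q = g := by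
  refine P.act_injective (p := p) ?_
  rw [h, P.act_div]
  rw [← h, P.proj_act]

theorem div_act_right {p q : P.Total} (h : P.proj p = P.proj q) (g : G) :
    P.div p (q <• g) = P.div p q * g := by
  refine P.div_eq ?_
  rw [MulOpposite.op_mul, mul_smul, P.act_div h]

/-- In a local trivialization with fibre coordinate `κ`, the translation from $p$ to $q$ is
$\kappa(p)^{-1}\kappa(q)$. -/
theorem continuousOn_div [IsTopologicalGroup G] :
    ContinuousOn (fun z : P.Total × P.Total => P.div z.1 z.2) {z | P.proj z.1 = P.proj z.2} := by
  rintro ⟨p, q⟩ (hpq : P.proj p = P.proj q)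
  obtain ⟨U, hU, hm, σ, κ, -, hκ, -, hσ, -⟩ := P.exists_local_section (P.proj p)
  have hU' : IsOpen (P.proj ⁻¹' U) := hU.preimage P.proj.continuous
  have h1 : ContinuousAt κ p := hκ.continuousAt (hU'.mem_nhds hm)
  have h2 : ContinuousAt κ q := hκ.continuousAt (hU'.mem_nhds (by simpa [← hpq] using hm))
  have h3 : ContinuousAt (fun z : P.Total × P.Total => (κ z.1)⁻¹ * κ z.2) (p, q) := by
    refine (ContinuousAt.inv ?_).mul ?_
    · exact ContinuousAt.comp (f := Prod.fst) h1 continuousAt_fst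
    · exact ContinuousAt.comp (f := Prod.snd) h2 continuousAt_snd
  have hV : ∀ᶠ z in 𝓝[{z | P.proj z.1 = P.proj z.2}] ((p, q) : P.Total × P.Total),
      P.div z.1 z.2 = (κ z.1)⁻¹ * κ z.2 := by
    have : ∀ᶠ z in 𝓝[{z | P.proj z.1 = P.proj z.2}] ((p, q) : P.Total × P.Total),
        z.1 ∈ P.proj ⁻¹' U :=
      nhdsWithin_le_nhds (continuousAt_fst.eventually (hU'.mem_nhds hm))
    filter_upwards [this, self_mem_nhdsWithin] with z hz (hz' : P.proj z.1 = P.proj z.2)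
    refine P.div_eq ?_
    have e1 := hσ z.1 hz
    have e2 := hσ z.2 (by rw [← hz']; exact hz)
    rw [← hz'] at e2
    exact P.act_inv_mul e1 e2
  refine h3.continuousWithinAt.congr_of_eventuallyEq hV ?_
  exact hV.self_of_nhdsWithin hpq

theorem _root_.ContinuousOn.bundle_div [IsTopologicalGroup G] {Y : Type*} [TopologicalSpace Y]
    {f k : Y → P.Total} {s : Set Y} (hf : ContinuousOn f s) (hk : ContinuousOn k s)
    (h : ∀ y ∈ s, P.proj (f y) = P.proj (k y)) : ContinuousOn (fun y => P.div (f y) (k y)) s :=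
  P.continuousOn_div.comp (hf.prodMk hk) h

theorem _root_.ContinuousOn.bundle_act {Y : Type*} [TopologicalSpace Y]
    {f : Y → P.Total} {g : Y → G} {s : Set Y} (hf : ContinuousOn f s) (hg : ContinuousOn g s) :
    ContinuousOn (fun y => f y <• g y) s :=
  (MulOpposite.continuous_op.comp_continuousOn hg).smul hf

/-- Through each point $p$ passes a local section, namely $\sigma$ translated by $\kappa(p)$.
Openness matters because it survives products with $[0,1]$, which being a quotient map alone need
not. -/
theorem isOpenQuotientMap_proj : IsOpenQuotientMap P.proj where
  surjective m := by
    obtain ⟨U, -, hm, σ, -, -, -, h, -⟩ := P.exists_local_section m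
    exact ⟨σ m, h m hm⟩
  continuous := P.proj.continuous
  isOpenMap := by
    refine IsOpenMap.of_nhds_le fun p => ?_
    obtain ⟨U, hU, hm, σ, κ, hσ, -, hpσ, hσκ, -⟩ := P.exists_local_section (P.proj p)
    intro s hs
    have hc : ContinuousAt (fun x => σ x <• κ p) (P.proj p) :=
      (hσ.continuousAt (hU.mem_nhds hm)).const_smul _
    have h1 : ∀ᶠ x in 𝓝 (P.proj p), σ x <• κ p ∈ P.proj ⁻¹' s := by
      refine hc ?_
      simp only [hσκ p hm]
      exact hs
    filter_upwards [h1, hU.mem_nhds hm] with x hx hxU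
    have : P.proj (σ x <• κ p) ∈ s := hx
    rwa [P.proj_act, hpσ x hxU] at this

/-- An equivariant map of principal bundles over the identity is a homeomorphism. -/
theorem exists_homeomorph [IsTopologicalGroup G] (Q : PrincipalBundle G M)
    (e : C(P.Total, Q.Total)) (he : ∀ p, Q.proj (e p) = P.proj p)
    (he' : ∀ (p : P.Total) (g : G), e (p <• g) = e p <• g) :
    ∃ e' : P.Total ≃ₜ Q.Total, ∀ p, e' p = e p := by
  have hb : Function.Bijective e := by
    constructor
    · intro p q h
      have hpq : P.proj p = P.proj q := by rw [← he, ← he, h]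
      obtain ⟨g, rfl⟩ := P.exists_act_eq hpq
      rw [he'] at h
      have : (1 : G) = g := Q.act_injective (p := e p) (by simpa using h)
      simp [← this]
    · intro q
      obtain ⟨p, hp⟩ := P.isOpenQuotientMap_proj.surjective (Q.proj q)
      obtain ⟨g, hg⟩ := Q.exists_act_eq (p := e p) (q := q) (by rw [he, hp])
      exact ⟨p <• g, by rw [he', hg]⟩
  refine ⟨⟨Equiv.ofBijective e hb, e.continuous, ?_⟩, fun p => rfl⟩
  refine continuous_iff_continuousAt.2 fun q => ?_
  obtain ⟨U, hU, hm, σ, -, hσ, -, hpσ, -, -⟩ := P.exists_local_section (Q.proj q)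
  have hU' : IsOpen (Q.proj ⁻¹' U) := hU.preimage Q.proj.continuous
  have hσ' : ContinuousOn (fun q => σ (Q.proj q)) (Q.proj ⁻¹' U) :=
    hσ.comp Q.proj.continuous.continuousOn fun _ h => h
  -- The local formula for the inverse: compare `q` with the image of a section of `P` and translate
  -- that section accordingly.
  have hc : ContinuousOn (fun q => σ (Q.proj q) <• Q.div (e (σ (Q.proj q))) q) (Q.proj ⁻¹' U) := by
    refine hσ'.bundle_act P (ContinuousOn.bundle_div Q (e.continuous.comp_continuousOn hσ')
      continuousOn_id fun q hq => ?_)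
    rw [he, hpσ _ hq]
  refine (hc.continuousAt (hU'.mem_nhds hm)).congr ?_
  filter_upwards [hU'.mem_nhds hm] with q' hq'
  apply (Equiv.ofBijective e hb).injective
  change e _ = Equiv.ofBijective e hb ((Equiv.ofBijective e hb).symm q')
  rw [Equiv.apply_symm_apply, he', Q.act_div]
  rw [he, hpσ _ hq']

end

end PrincipalBundle

/-! ### Bump functions and ordered composition of locally finite families -/

/-- A locally finite family of functions to `[0, 1]`, subordinate to a given open cover, such that
at every point one of them takes the value `1`. -/
theorem exists_bump_functions {M : Type*} [TopologicalSpace M] [T2Space M] [ParacompactSpace M]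
    (U : M → Set M) (hU : ∀ m, IsOpen (U m)) (hm : ∀ m, m ∈ U m) :
    ∃ ρ : M → C(M, unitInterval), LocallyFinite (fun i => Function.support (ρ i)) ∧
      (∀ i, tsupport (ρ i) ⊆ U i) ∧ ∀ x, ∃ i, ρ i x = 1 := by
  obtain ⟨f, hf⟩ := BumpCovering.exists_isSubordinate isClosed_univ U hU
    fun m _ => mem_iUnion.2 ⟨m, hm m⟩
  let ρ : M → C(M, unitInterval) := fun i =>
    ⟨fun x => ⟨f i x, f.nonneg i x, f.le_one i x⟩, by fun_prop⟩
  have hs : ∀ i, Function.support (ρ i) = Function.support (f i) := fun i => by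
    ext x
    simp only [Function.mem_support, ne_eq, not_iff_not]
    exact ⟨fun h => congrArg Subtype.val h, fun h => Subtype.ext h⟩
  refine ⟨ρ, ?_, fun i => ?_, fun x => ?_⟩
  · simp only [hs]
    exact f.locallyFinite
  · rw [tsupport, hs]
    exact hf i
  · obtain ⟨i, hi⟩ := f.eventuallyEq_one' x (mem_univ x)
    exact ⟨i, Subtype.ext hi.self_of_nhds⟩

/-- Maps that fix the whole fibre of $z$ can be dropped from a composition. Preservation of $\pi$ is
part of the induction, since it keeps the intermediate points in that fibre. -/
theorem List.foldr_filter_of_fixed {ι Z M : Type*} {π : Z → M} {K : ι → Z → Z} {p : ι → Bool}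
    (l : List ι) (z : Z)
    (hπ : ∀ i z, π (K i z) = π z)
    (hK : ∀ i z', p i = false → π z' = π z → K i z' = z') :
    π (l.foldr K z) = π z ∧ (l.filter p).foldr K z = l.foldr K z := by
  induction l with
  | nil => simp
  | cons i l ih =>
    refine ⟨by rw [List.foldr_cons, hπ, ih.1], ?_⟩
    by_cases h : p i
    · simp [h, ih.2]
    · have h' : p i = false := by simpa using h
      rw [List.filter_cons, if_neg h, ih.2, List.foldr_cons, hK i _ h' ih.1]

section OrderedComposition

variable {ι Z M : Type*} [LinearOrder ι] [TopologicalSpace M] {S : ι → Set M}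

/-- The list, in increasing order, of the indices `i` with `m ∈ S i`. -/
noncomputable def activeList (hS : LocallyFinite S) (m : M) : List ι :=
  (hS.point_finite m).toFinset.sort (· ≤ ·)

/-- The composition, in the order of `ι`, of those `K i` with `π z ∈ S i`. -/
noncomputable def orderedComp (hS : LocallyFinite S) (π : Z → M) (K : ι → Z → Z) (z : Z) : Z :=
  (activeList hS (π z)).foldr K z

variable {hS : LocallyFinite S} {π : Z → M} {K : ι → Z → Z}

/-- The active list jumps from point to point; enlarging it to `T` adds only maps that fix the fibre
of `z`, so one finite list can serve a neighbourhood. -/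
theorem orderedComp_eq_foldr (hπ : ∀ i z, π (K i z) = π z) (hK : ∀ i z, π z ∉ S i → K i z = z)
    (z : Z) (T : Finset ι) (hT : ∀ i, π z ∈ S i → i ∈ T) :
    orderedComp hS π K z = (T.sort (· ≤ ·)).foldr K z := by
  classical
  let p : ι → Bool := fun i => decide (π z ∈ S i)
  have h := (List.foldr_filter_of_fixed (K := K) (p := p) (T.sort (· ≤ ·)) z hπ
    (fun i z' hi e => hK i z' (by rw [e]; simpa [p] using hi))).2
  rw [← h, orderedComp, activeList]
  congr 1
  refine List.Perm.eq_of_pairwise' (r := (· ≤ ·)) (Finset.pairwise_sort _ _)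
    ((Finset.pairwise_sort _ _).filter _) ?_
  rw [List.perm_ext_iff_of_nodup (Finset.sort_nodup _ _) ((Finset.sort_nodup _ _).filter _)]
  intro i
  simp only [Finset.mem_sort, Finite.mem_toFinset, mem_ofPred_eq, List.mem_filter, p,
    decide_eq_true_eq]
  exact ⟨fun hi => ⟨hT i hi, hi⟩, fun hi => hi.2⟩

theorem continuous_orderedComp [TopologicalSpace Z] (hπc : Continuous π)
    (hπ : ∀ i z, π (K i z) = π z) (hK : ∀ i z, π z ∉ S i → K i z = z)
    (hc : ∀ i, Continuous (K i)) : Continuous (orderedComp hS π K) := by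
  refine continuous_iff_continuousAt.2 fun z => ?_
  obtain ⟨W, hW, hfin⟩ := hS (π z)
  have hl : ∀ l : List ι, Continuous fun z => l.foldr K z := fun l => by
    induction l with
    | nil => exact continuous_id
    | cons i l ih => exact (hc i).comp ih
  refine (hl (hfin.toFinset.sort (· ≤ ·))).continuousAt.congr ?_
  filter_upwards [hπc.continuousAt hW] with z' hz'
  refine (orderedComp_eq_foldr hπ hK z' _ fun i hi => ?_).symm
  simp only [Finite.mem_toFinset, mem_ofPred_eq]
  exact ⟨π z', hi, hz'⟩

theorem orderedComp_induction {p : Z → Prop} {z : Z} (h0 : p z) (h1 : ∀ i z, p z → p (K i z)) :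
    p (orderedComp hS π K z) := by
  unfold orderedComp
  induction activeList hS (π z) with
  | nil => exact h0
  | cons i l ih => exact h1 i _ ih

theorem orderedComp_induction₂ {q : Z → Z → Prop} {z z' : Z} (e : π z = π z') (h0 : q z z')
    (h1 : ∀ j z z', q z z' → q (K j z) (K j z')) :
    q (orderedComp hS π K z) (orderedComp hS π K z') := by
  unfold orderedComp
  rw [← e]
  induction activeList hS (π z) with
  | nil => exact h0
  | cons i l ih => exact h1 i _ _ ih

/-- If all `K j` preserve the relations `q` and `r`, and one of those that enter the composition
improves `q` to `r`, then so does the composition. -/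
theorem orderedComp_improve {q r : Z → Z → Prop} {z z' : Z} (e : π z = π z') {i : ι}
    (hi : π z ∈ S i) (hq : q z z') (hq' : ∀ j z z', q z z' → q (K j z) (K j z'))
    (hr : ∀ z z', q z z' → r (K i z) (K i z')) (hr' : ∀ j z z', r z z' → r (K j z) (K j z')) :
    r (orderedComp hS π K z) (orderedComp hS π K z') := by
  have hi' : i ∈ activeList hS (π z) := by simpa [activeList] using hi
  unfold orderedComp
  rw [← e]
  have hl : ∀ l : List ι, q (l.foldr K z) (l.foldr K z') ∧
      (i ∈ l → r (l.foldr K z) (l.foldr K z')) := fun l => by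
    induction l with
    | nil => simpa using hq
    | cons j l ih =>
      refine ⟨hq' j _ _ ih.1, fun h => ?_⟩
      rcases List.mem_cons.1 h with rfl | h
      · exact hr _ _ ih.1
      · exact hr' j _ _ (ih.2 h)
  exact (hl _).2 hi'

end OrderedComposition

/-! ### Equivariant maps into a contractible $G$-space -/

namespace PrincipalBundle

section

variable {G : Type u} [Group G] [TopologicalSpace G] [IsTopologicalGroup G] {M : Type u}
  [TopologicalSpace M] [T2Space M] [ParacompactSpace M] (P : PrincipalBundle G M)
  {Y : Type*} [TopologicalSpace Y] [MulAction Gᵐᵒᵖ Y] [ContinuousSMul Gᵐᵒᵖ Y] [ContractibleSpace Y]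

/-- An equivariant deformation of maps from a principal bundle to a contractible `G`-space: it
starts at the given map, and its end does not depend on the given map. -/
theorem exists_equivariant_deformation : ∃ A : C(P.Total × Y × unitInterval, Y),
    (∀ p y s (g : G), A (p <• g, y <• g, s) = A (p, y, s) <• g) ∧
    (∀ p y, A (p, y, 0) = y) ∧ (∀ p y y', A (p, y, 1) = A (p, y', 1)) := by
  obtain ⟨y₀, ⟨c⟩⟩ := id_nullhomotopic Y
  choose U hU hmU σ _ hσ _ hpσ _ _ using P.exists_local_section
  obtain ⟨ρ, hS, hρU, hρ1⟩ := exists_bump_functions U hU hmU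
  -- The local deformations need not commute; any linear order of the indices fixes the order of
  -- composition.
  let _ : LinearOrder M := IsWellOrder.linearOrder WellOrderingRel
  let γ : M → P.Total → G := fun i p => P.div (σ i (P.proj p)) p
  have hγ : ∀ i p (g : G), P.proj p ∈ U i → γ i (p <• g) = γ i p * g := fun i p g hp => by
    simp only [γ, P.proj_act]
    exact P.div_act_right (hpσ i _ hp) g
  have hγc : ∀ i, ContinuousOn (γ i) (P.proj ⁻¹' U i) := fun i =>
    ContinuousOn.bundle_div P ((hσ i).comp P.proj.continuous.continuousOn fun _ h => h)
      continuousOn_id fun p hp => hpσ i _ hp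
  let Z := P.Total × Y × unitInterval
  let π : Z → M := fun z => P.proj z.1
  -- The contraction `c` carried out in the trivialization of `σ i`: undo the fibre coordinate `γ
  -- i`, contract for time $s\rho_i$, restore the coordinate. Equivariance of `γ i` makes this
  -- equivariant.
  let K : M → Z → Z := fun i z =>
    (z.1, c (z.2.2 * ρ i (π z), z.2.1 <• (γ i z.1)⁻¹) <• γ i z.1, z.2.2)
  have hπ : ∀ i z, π (K i z) = π z := fun i z => rfl
  have hK0 : ∀ i z, z.2.2 * ρ i (π z) = 0 → K i z = z := fun i z hz => by
    refine Prod.ext rfl (Prod.ext ?_ rfl)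
    change c (z.2.2 * ρ i (π z), z.2.1 <• (γ i z.1)⁻¹) <• γ i z.1 = z.2.1
    rw [hz, c.apply_zero]
    simp
  have hK : ∀ i z, π z ∉ Function.support (ρ i) → K i z = z := fun i z hz =>
    hK0 i z (by rw [Function.notMem_support.1 hz, mul_zero])
  have hπc : Continuous π := P.proj.continuous.comp continuous_fst
  have hKc : ∀ i, Continuous (K i) := fun i => by
    refine continuous_iff_continuousAt.2 fun z => ?_
    -- The formula is continuous over `U i`, and `K i` is the identity off the closed support of `ρ
    -- i`; these two open regions cover.
    by_cases hz : π z ∈ tsupport (ρ i)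
    · have hV : IsOpen (π ⁻¹' U i) := (hU i).preimage hπc
      have h1 : ContinuousOn (fun z : Z => γ i z.1) (π ⁻¹' U i) :=
        (hγc i).comp continuous_fst.continuousOn fun _ h => h
      have h2 : ContinuousOn (fun z : Z => z.2.1 <• (γ i z.1)⁻¹) (π ⁻¹' U i) :=
        (MulOpposite.continuous_op.comp_continuousOn h1.inv).smul
          (continuous_fst.comp continuous_snd).continuousOn
      have h3 : Continuous fun z : Z => z.2.2 * ρ i (π z) := by fun_prop
      have h4 : ContinuousOn (fun z : Z =>
          c (z.2.2 * ρ i (π z), z.2.1 <• (γ i z.1)⁻¹) <• γ i z.1) (π ⁻¹' U i) :=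
        (MulOpposite.continuous_op.comp_continuousOn h1).smul
          (c.continuous.comp_continuousOn (h3.continuousOn.prodMk h2))
      have h5 : ContinuousOn (K i) (π ⁻¹' U i) :=
        continuous_fst.continuousOn.prodMk
          (h4.prodMk (continuous_snd.comp continuous_snd).continuousOn)
      exact h5.continuousAt (hV.mem_nhds (hρU i hz))
    · refine continuousAt_id.congr ?_
      filter_upwards [((isClosed_tsupport (ρ i)).isOpen_compl.preimage hπc).mem_nhds hz] with z' hz'
      exact (hK i z' fun h => hz' (subset_tsupport _ h)).symm
  let A : Z → Z := orderedComp hS π K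
  have hA : Continuous A := continuous_orderedComp hπc hπ hK hKc
  refine ⟨⟨fun z => (A z).2.1, continuous_fst.comp (continuous_snd.comp hA)⟩,
    fun p y s g => ?_, fun p y => ?_, fun p y y' => ?_⟩
  · let q : Z → Z → Prop := fun z z' => z'.1 = z.1 <• g ∧ z'.2.1 = z.2.1 <• g ∧ z'.2.2 = z.2.2
    have : q (A (p, y, s)) (A (p <• g, y <• g, s)) := by
      refine orderedComp_induction₂ (P.proj_act p g).symm ⟨rfl, rfl, rfl⟩ ?_
      rintro i ⟨p, y, s⟩ ⟨p', y', s'⟩ ⟨h1, h2, h3⟩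
      dsimp only at h1 h2 h3
      subst h1 h2 h3
      refine ⟨rfl, ?_, rfl⟩
      by_cases hp : P.proj p ∈ Function.support (ρ i)
      · change c (s' * ρ i (P.proj (p <• g)), (y <• g) <• (γ i (p <• g))⁻¹) <• γ i (p <• g) =
          c (s' * ρ i (P.proj p), y <• (γ i p)⁻¹) <• γ i p <• g
        rw [P.proj_act, hγ i p g (hρU i (subset_tsupport _ hp))]
        simp [smul_smul]
      · have hp' : P.proj (p <• g) ∉ Function.support (ρ i) := by rwa [P.proj_act]
        rw [hK i (p, y, s') hp, hK i (p <• g, y <• g, s') hp']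
    exact this.2.1
  · have : (A (p, y, 0)).2.1 = y ∧ (A (p, y, 0)).2.2 = 0 := by
      refine orderedComp_induction (p := fun z : Z => z.2.1 = y ∧ z.2.2 = 0) ⟨rfl, rfl⟩ ?_
      rintro i z ⟨h1, h2⟩
      rw [hK0 i z (by rw [h2, zero_mul])]
      exact ⟨h1, h2⟩
    exact this.1
  -- Where $s=\rho_i=1$, `K i` sends every $y$ to $y_0\gamma_i(p)$. The starting point is lost at
  -- this factor, and later factors cannot recover it.
  · obtain ⟨i, hi⟩ := hρ1 (P.proj p)
    let q : Z → Z → Prop := fun z z' => z.1 = p ∧ z'.1 = p ∧ z.2.2 = 1 ∧ z'.2.2 = 1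
    have : A (p, y, 1) = A (p, y', 1) := by
      refine orderedComp_improve (q := q) (r := Eq) rfl (i := i) ?_ ⟨rfl, rfl, rfl, rfl⟩
        (fun j z z' h => h) ?_ (fun j z z' h => congrArg _ h)
      · change ρ i (P.proj p) ≠ 0
        rw [hi]
        exact one_ne_zero
      · rintro ⟨p₁, y₁, s₁⟩ ⟨p₂, y₂, s₂⟩ ⟨h1, h2, h3, h4⟩
        dsimp only at h1 h2 h3 h4
        rw [h1, h2, h3, h4]
        refine Prod.ext rfl (Prod.ext ?_ rfl)
        change c (1 * ρ i (P.proj p), _) <• γ i p = c (1 * ρ i (P.proj p), _) <• γ i p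
        rw [hi, mul_one, c.apply_one, c.apply_one]
        rfl
    exact congrArg (fun z : Z => z.2.1) this

/-- The end of the deformation forgets its start, so starting everywhere at one fixed `y`, which is
not equivariant, still ends equivariantly. -/
theorem exists_equivariant_map :
    ∃ f : C(P.Total, Y), ∀ (p : P.Total) (g : G), f (p <• g) = f p <• g := by
  obtain ⟨A, hA, -, hA1⟩ := P.exists_equivariant_deformation (Y := Y)
  obtain ⟨y⟩ : Nonempty Y := inferInstance
  refine ⟨⟨fun p => A (p, y, 1), by fun_prop⟩, fun p g => ?_⟩
  change A (p <• g, y, 1) = A (p, y, 1) <• g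
  rw [← hA, hA1 _ y]

/-- Two equivariant maps from a principal bundle to a contractible `G`-space are homotopic through
equivariant maps. -/
theorem exists_equivariant_homotopy (f₀ f₁ : C(P.Total, Y))
    (h₀ : ∀ (p : P.Total) (g : G), f₀ (p <• g) = f₀ p <• g)
    (h₁ : ∀ (p : P.Total) (g : G), f₁ (p <• g) = f₁ p <• g) :
    ∃ h : f₀.Homotopy f₁, ∀ s p (g : G), h (s, p <• g) = h (s, p) <• g := by
  obtain ⟨A, hA, hA0, hA1⟩ := P.exists_equivariant_deformation (Y := Y)
  have key : ∀ f : C(P.Total, Y), (∀ (p : P.Total) (g : G), f (p <• g) = f p <• g) →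
      ∀ (s : unitInterval) p (g : G), A (p <• g, f (p <• g), s) = A (p, f p, s) <• g :=
    fun f hf s p g => by rw [hf, hA]
  -- Both maps deform to this common end; the homotopy runs there from `f₀` and back to `f₁`.
  let F : C(P.Total, Y) := ⟨fun p => A (p, f₀ p, 1), by fun_prop⟩
  let k₀ : f₀.Homotopy F :=
    { toFun := fun z => A (z.2, f₀ z.2, z.1)
      continuous_toFun := by fun_prop
      map_zero_left := fun p => hA0 _ _
      map_one_left := fun p => rfl }
  let k₁ : f₁.Homotopy F :=
    { toFun := fun z => A (z.2, f₁ z.2, z.1)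
      continuous_toFun := by fun_prop
      map_zero_left := fun p => hA0 _ _
      map_one_left := fun p => hA1 _ _ _ }
  refine ⟨k₀.trans k₁.symm, fun s p g => ?_⟩
  rw [ContinuousMap.Homotopy.trans_apply, ContinuousMap.Homotopy.trans_apply]
  split_ifs
  · exact key f₀ h₀ _ p g
  · rw [ContinuousMap.Homotopy.symm_apply, ContinuousMap.Homotopy.symm_apply]
    exact key f₁ h₁ _ p g

end

end PrincipalBundle

/-! ### Bibundles of constant type over $[0,1]\times M$ -/

section

variable {G H : Type u} [Group G] [TopologicalSpace G] [Group H]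
  [TopologicalSpace H] {X : TopCrossedModule G H} {M : Type u}
  [TopologicalSpace M]

theorem TopCrossedModule.exists_local_lift (hG : HasLocalSections X.t.toMonoidHom.rangeRestrict) :
    ∃ (W : Set H) (l : H → G), IsOpen W ∧ 1 ∈ W ∧ ContinuousOn l (W ∩ X.tG) ∧
      ∀ h ∈ W ∩ (X.tG : Set H), X.t (l h) = h := by
  classical
  obtain ⟨W₀, hW₀, h1, s, hs⟩ := hG 1
  obtain ⟨W, hW, rfl⟩ := isOpen_induced_iff.1 hW₀
  let l : H → G := fun h =>
    if hh : h ∈ W ∩ (X.tG : Set H) then s ⟨⟨h, hh.2⟩, hh.1⟩ else 1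
  have hl : ∀ h (hh : h ∈ W ∩ (X.tG : Set H)), l h = s ⟨⟨h, hh.2⟩, hh.1⟩ := fun h hh => dif_pos hh
  refine ⟨W, l, hW, h1, ?_, fun h hh => ?_⟩
  · rw [continuousOn_iff_continuous_domRestrict]
    have : (W ∩ (X.tG : Set H)).domRestrict l = fun h => s ⟨⟨h.1, h.2.2⟩, h.2.1⟩ :=
      funext fun h => hl h.1 h.2
    rw [this]
    fun_prop
  · rw [hl h hh]
    exact congrArg Subtype.val (hs ⟨⟨h, hh.2⟩, hh.1⟩)

namespace Bibundle

/-- The type map of a bibundle over `[0, 1] × M` does not depend on the first variable. -/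
def HasConstantType (R : Bibundle X (unitInterval × M)) : Prop :=
  ∀ p q : R.Total, (R.proj p).2 = (R.proj q).2 →
    (QuotientGroup.mk (R.ψ p) : H ⧸ X.tG) = QuotientGroup.mk (R.ψ q)

/-- A continuous section over `J ×ˢ V` on which the structure map depends only on the point
of `V`. -/
structure IsConstantSection (R : Bibundle X (unitInterval × M)) (J : Set unitInterval) (V : Set M)
    (s : unitInterval × M → R.Total) : Prop where
  continuousOn : ContinuousOn s (J ×ˢ V)
  proj_eq : ∀ z ∈ J ×ˢ V, R.proj (s z) = z
  ψ_eq : ∀ r ∈ J, ∀ r' ∈ J, ∀ x ∈ V, R.ψ (s (r, x)) = R.ψ (s (r', x))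

variable {R : Bibundle X (unitInterval × M)}

theorem IsConstantSection.mono {J J' : Set unitInterval} {V V' : Set M}
    {s : unitInterval × M → R.Total} (hs : R.IsConstantSection J V s) (hJ : J' ⊆ J) (hV : V' ⊆ V) :
    R.IsConstantSection J' V' s where
  continuousOn := hs.continuousOn.mono (prod_mono hJ hV)
  proj_eq z hz := hs.proj_eq z (prod_mono hJ hV hz)
  ψ_eq r hr r' hr' x hx := hs.ψ_eq r (hJ hr) r' (hJ hr') x (hV hx)

/-- Any local section can be corrected: the change of $\psi$ along it since time $r_0$ lies in
$t(G)$ and is near $1$, so it lifts to $G$ and can be translated away. -/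
theorem HasConstantType.exists_isConstantSection_nhds [IsTopologicalGroup G] [IsTopologicalGroup H]
    (hR : R.HasConstantType)
    (hG : HasLocalSections X.t.toMonoidHom.rangeRestrict) (r₀ : unitInterval) (x₀ : M) :
    ∃ (J : Set unitInterval) (V : Set M) (s : unitInterval × M → R.Total),
      IsOpen J ∧ r₀ ∈ J ∧ IsOpen V ∧ x₀ ∈ V ∧ R.IsConstantSection J V s := by
  obtain ⟨W, l, hW, h1W, hl, htl⟩ := TopCrossedModule.exists_local_lift hG
  obtain ⟨U, hU, hmU, σ, -, hσ, -, hpσ, -, -⟩ :=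
    R.toPrincipalBundle.exists_local_section (r₀, x₀)
  obtain ⟨J₁, V₁, hJ₁, hV₁, hr₁, hx₁, hJV₁⟩ := isOpen_prod_iff.1 hU r₀ x₀ hmU
  let a : unitInterval × M → H := fun z => (R.ψ (σ (r₀, z.2)))⁻¹ * R.ψ (σ z)
  have ha : ContinuousOn a (J₁ ×ˢ V₁) := by
    have h1 : ContinuousOn (fun z => R.ψ (σ z)) (J₁ ×ˢ V₁) :=
      R.ψ.continuous.comp_continuousOn (hσ.mono hJV₁)
    have h2 : ContinuousOn (fun z : unitInterval × M => R.ψ (σ (r₀, z.2))) (J₁ ×ˢ V₁) :=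
      h1.comp (f := fun z : unitInterval × M => (r₀, z.2)) (by fun_prop) fun z hz => ⟨hr₁, hz.2⟩
    exact h2.inv.mul h1
  have hat : ∀ z ∈ J₁ ×ˢ V₁, a z ∈ X.tG := fun z hz => by
    refine QuotientGroup.eq.1 (hR _ _ ?_)
    rw [hpσ _ (hJV₁ (show (r₀, z.2) ∈ J₁ ×ˢ V₁ from ⟨hr₁, hz.2⟩)), hpσ _ (hJV₁ hz)]
  have hN : IsOpen ((J₁ ×ˢ V₁) ∩ a ⁻¹' W) := ha.isOpen_inter_preimage (hJ₁.prod hV₁) hW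
  obtain ⟨J, V, hJ, hV, hr, hx, hJV⟩ := isOpen_prod_iff.1 hN r₀ x₀ ⟨⟨hr₁, hx₁⟩, by
    change (R.ψ (σ (r₀, x₀)))⁻¹ * R.ψ (σ (r₀, x₀)) ∈ W
    rwa [inv_mul_cancel]⟩
  refine ⟨J, V, fun z => σ z <• (l (a z))⁻¹, hJ, hr, hV, hx, ?_, fun z hz => ?_, ?_⟩
  · refine ContinuousOn.bundle_act _ (hσ.mono fun z hz => hJV₁ (hJV hz).1) (ContinuousOn.inv ?_)
    exact hl.comp (ha.mono fun z hz => (hJV hz).1) fun z hz => ⟨(hJV hz).2, hat z (hJV hz).1⟩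
  · rw [R.proj_act, hpσ z (hJV₁ (hJV hz).1)]
  · have key : ∀ r ∈ J, ∀ x ∈ V, R.ψ (σ (r, x) <• (l (a (r, x)))⁻¹) = R.ψ (σ (r₀, x)) := by
      intro r hr x hx
      have hz := hJV (show (r, x) ∈ J ×ˢ V from ⟨hr, hx⟩)
      rw [R.ψ_act, map_inv, htl _ ⟨hz.2, hat _ hz.1⟩]
      simp [a]
    intro r hr r' hr' x hx
    exact (key r hr x hx).trans (key r' hr' x hx).symm

/-- Translate `s₂` to agree with `s₁` at time $c$. The translating element depends only on the point
of `V`, so $\psi$ stays constant in time. -/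
theorem IsConstantSection.glue [IsTopologicalGroup G] {b c d : unitInterval} (hbc : b ≤ c) (hcd : c ≤ d)
    {V : Set M} {s₁ s₂ : unitInterval × M → R.Total} (h₁ : R.IsConstantSection (Icc b c) V s₁)
    (h₂ : R.IsConstantSection (Icc c d) V s₂) : ∃ s, R.IsConstantSection (Icc b d) V s := by
  classical
  let g : M → G := fun x => R.toPrincipalBundle.div (s₂ (c, x)) (s₁ (c, x))
  have hc₁ : ∀ x ∈ V, (c, x) ∈ Icc b c ×ˢ V := fun x hx => ⟨⟨hbc, le_rfl⟩, hx⟩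
  have hc₂ : ∀ x ∈ V, (c, x) ∈ Icc c d ×ˢ V := fun x hx => ⟨⟨le_rfl, hcd⟩, hx⟩
  have hpc : ∀ x ∈ V, R.proj (s₂ (c, x)) = R.proj (s₁ (c, x)) := fun x hx => by
    rw [h₁.proj_eq _ (hc₁ x hx), h₂.proj_eq _ (hc₂ x hx)]
  have hgs : ∀ x ∈ V, s₂ (c, x) <• g x = s₁ (c, x) := fun x hx =>
    R.toPrincipalBundle.act_div (hpc x hx)
  have hg : ContinuousOn g V := ContinuousOn.bundle_div _
    (h₂.continuousOn.comp (f := fun x => (c, x)) (by fun_prop) hc₂)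
    (h₁.continuousOn.comp (f := fun x => (c, x)) (by fun_prop) hc₁) hpc
  have hs₂ : ContinuousOn (fun z => s₂ z <• g z.2) (Icc c d ×ˢ V) :=
    h₂.continuousOn.bundle_act _ (hg.comp continuous_snd.continuousOn fun z hz => hz.2)
  have hψ : ∀ r ∈ Icc c d, ∀ x ∈ V, R.ψ (s₂ (r, x) <• g x) = R.ψ (s₁ (c, x)) := by
    intro r hr x hx
    rw [R.ψ_act, h₂.ψ_eq r hr c ⟨le_rfl, hcd⟩ x hx, ← R.ψ_act, hgs x hx]
  have hψ' : ∀ r ∈ Icc b d, ∀ x ∈ V,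
      R.ψ (if r ≤ c then s₁ (r, x) else s₂ (r, x) <• g x) = R.ψ (s₁ (c, x)) := by
    intro r hr x hx
    split_ifs with h
    · exact h₁.ψ_eq r ⟨hr.1, h⟩ c ⟨hbc, le_rfl⟩ x hx
    · exact hψ r ⟨(not_le.1 h).le, hr.2⟩ x hx
  refine ⟨fun z => if z.1 ≤ c then s₁ z else s₂ z <• g z.2, ?_, ?_, ?_⟩
  · have hcl : IsClosed {z : unitInterval × M | z.1 ≤ c} :=
      isClosed_le continuous_fst continuous_const
    have hcl' : closure {z : unitInterval × M | ¬ z.1 ≤ c} ⊆ {z | c ≤ z.1} :=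
      closure_minimal (fun z hz => (not_le.1 hz).le) (isClosed_le continuous_const continuous_fst)
    refine ContinuousOn.if ?_ (h₁.continuousOn.mono ?_) (hs₂.mono ?_)
    · rintro ⟨r, x⟩ ⟨hz, hf⟩
      have : r = c := frontier_le_subset_eq continuous_fst continuous_const hf
      subst this
      exact (hgs x hz.2).symm
    · rw [hcl.closure_eq]
      rintro z ⟨hz, hz'⟩
      exact ⟨⟨hz.1.1, hz'⟩, hz.2⟩
    · rintro z ⟨hz, hz'⟩
      exact ⟨⟨hcl' hz', hz.1.2⟩, hz.2⟩
  · intro z hz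
    split_ifs with h
    · exact h₁.proj_eq z ⟨⟨hz.1.1, h⟩, hz.2⟩
    · rw [R.proj_act]
      exact h₂.proj_eq z ⟨⟨(not_le.1 h).le, hz.1.2⟩, hz.2⟩
  · intro r hr r' hr' x hx
    exact (hψ' r hr x hx).trans (hψ' r' hr' x hx).symm

theorem HasConstantType.exists_isConstantSection [IsTopologicalGroup G] [IsTopologicalGroup H]
    (hR : R.HasConstantType)
    (hG : HasLocalSections X.t.toMonoidHom.rangeRestrict) (x₀ : M) :
    ∃ (V : Set M) (s : unitInterval × M → R.Total),
      IsOpen V ∧ x₀ ∈ V ∧ R.IsConstantSection univ V s := by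
  choose J V s hJ hrJ hV hxV hs using fun r => hR.exists_isConstantSection_nhds hG r x₀
  obtain ⟨t, ht0, htm, ⟨n, hn⟩, ht⟩ := exists_monotone_Icc_subset_open_cover_unitInterval hJ
    fun r _ => mem_iUnion.2 ⟨r, hrJ r⟩
  have key : ∀ k, ∃ (V : Set M) (s : unitInterval × M → R.Total),
      IsOpen V ∧ x₀ ∈ V ∧ R.IsConstantSection (Icc 0 (t k)) V s := fun k => by
    induction k with
    | zero =>
      -- The induction starts with the degenerate interval $[0,0]$, contained in the first
      -- subinterval.
      obtain ⟨i, hi⟩ := ht 0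
      refine ⟨V i, s i, hV i, hxV i, (hs i).mono (fun r hr => hi ?_) subset_rfl⟩
      rw [ht0] at hr ⊢
      exact ⟨hr.1, hr.2.trans (by simp)⟩
    | succ k ih =>
      obtain ⟨V', s', hV', hx', hs'⟩ := ih
      obtain ⟨i, hi⟩ := ht k
      obtain ⟨s'', hs''⟩ := IsConstantSection.glue (unitInterval.nonneg (t k)) (htm (Nat.le_succ k))
        (hs'.mono subset_rfl inter_subset_left) ((hs i).mono hi inter_subset_right)
      exact ⟨V' ∩ V i, s'', hV'.inter (hV i), ⟨hx', hxV i⟩, hs''⟩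
  obtain ⟨V, s, hV, hx, hs⟩ := key n
  refine ⟨V, s, hV, hx, hs.mono (fun r _ => ?_) subset_rfl⟩
  rw [hn n le_rfl]
  exact ⟨r.2.1, r.2.2⟩

/-- A bibundle over `[0, 1] × M` with constant type has a parallel transport to the end. -/
theorem HasConstantType.exists_transport [IsTopologicalGroup G] [IsTopologicalGroup H]
    [T2Space M] [ParacompactSpace M]
    (hR : R.HasConstantType) (hG : HasLocalSections X.t.toMonoidHom.rangeRestrict) :
    ∃ T : C(R.Total, R.Total), (∀ q, R.proj (T q) = (1, (R.proj q).2)) ∧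
      (∀ (q : R.Total) (g : G), T (q <• g) = T q <• g) ∧ ∀ q, R.ψ (T q) = R.ψ q := by
  choose U σ hU hmU hσ using hR.exists_isConstantSection hG
  obtain ⟨ρ, hS, hρU, hρ1⟩ := exists_bump_functions U hU hmU
  let _ : LinearOrder M := IsWellOrder.linearOrder WellOrderingRel
  let π : R.Total → M := fun q => (R.proj q).2
  have hπc : Continuous π := continuous_snd.comp R.proj.continuous
  -- Moves the time up to at least $\rho_i$ along `σ i`, keeping the fibre coordinate relative to `σ
  -- i`. Constancy of $\psi$ along `σ i` makes it preserve $\psi$; it is the identity where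
  -- $\rho_i=0$.
  let L : M → R.Total → R.Total := fun i q =>
    σ i ((R.proj q).1 ⊔ ρ i (π q), π q) <• R.toPrincipalBundle.div (σ i (R.proj q)) q
  have hpσ : ∀ i q, π q ∈ U i → R.proj (σ i (R.proj q)) = R.proj q := fun i q hq =>
    (hσ i).proj_eq _ ⟨mem_univ _, hq⟩
  have hσdiv : ∀ i q, π q ∈ U i →
      σ i (R.proj q) <• R.toPrincipalBundle.div (σ i (R.proj q)) q = q := fun i q hq =>
    R.toPrincipalBundle.act_div (hpσ i q hq)
  have hL0 : ∀ i q, π q ∈ U i → ρ i (π q) = 0 → L i q = q := fun i q hq h => by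
    have : ((R.proj q).1 ⊔ ρ i (π q), π q) = R.proj q := by
      rw [h]
      exact Prod.ext (sup_eq_left.2 unitInterval.nonneg') rfl
    simp only [L, this]
    exact hσdiv i q hq
  have hLc : ∀ i, ContinuousOn (L i) (π ⁻¹' U i) := fun i => by
    have h1 : ContinuousOn (fun q => σ i (R.proj q)) (π ⁻¹' U i) :=
      (hσ i).continuousOn.comp R.proj.continuous.continuousOn fun q hq => ⟨mem_univ _, hq⟩
    have h2 : Continuous fun q => ((R.proj q).1 ⊔ ρ i (π q), π q) := by fun_prop
    exact ((hσ i).continuousOn.comp h2.continuousOn fun q hq => ⟨mem_univ _, hq⟩).bundle_act _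
      (h1.bundle_div _ continuousOn_id fun q hq => hpσ i q hq)
  classical
  let K : M → R.Total → R.Total := fun i q =>
    if π q ∈ Function.support (ρ i) then L i q else q
  have hKU : ∀ i q, π q ∈ U i → K i q = L i q := fun i q hq => by
    by_cases h : π q ∈ Function.support (ρ i)
    · exact if_pos h
    · exact (if_neg h).trans (hL0 i q hq (Function.notMem_support.1 h)).symm
  have hK : ∀ i q, π q ∉ Function.support (ρ i) → K i q = q := fun i q hq => if_neg hq
  have hKc : ∀ i, Continuous (K i) := fun i => by
    refine continuous_iff_continuousAt.2 fun q => ?_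
    by_cases hq : π q ∈ tsupport (ρ i)
    · have hV : IsOpen (π ⁻¹' U i) := (hU i).preimage hπc
      refine ((hLc i).continuousAt (hV.mem_nhds (hρU i hq))).congr ?_
      filter_upwards [hV.mem_nhds (hρU i hq)] with q' hq'
      exact (hKU i q' hq').symm
    · refine continuousAt_id.congr ?_
      filter_upwards [((isClosed_tsupport (ρ i)).isOpen_compl.preimage hπc).mem_nhds hq] with q' hq'
      exact (hK i q' fun h => hq' (subset_tsupport _ h)).symm
  have hKproj : ∀ i q, R.proj (K i q) = ((R.proj q).1 ⊔ ρ i (π q), π q) := fun i q => by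
    by_cases h : π q ∈ Function.support (ρ i)
    · rw [hKU i q (hρU i (subset_tsupport _ h)), R.proj_act,
        (hσ i).proj_eq (_ ⊔ _, π q) ⟨mem_univ _, hρU i (subset_tsupport _ h)⟩]
    · rw [hK i q h, Function.notMem_support.1 h]
      exact Prod.ext (sup_eq_left.2 unitInterval.nonneg').symm rfl
  have hπ : ∀ i q, π (K i q) = π q := fun i q =>
    (congrArg Prod.snd (hKproj i q) :)
  have hKact : ∀ i q (g : G), K i (q <• g) = K i q <• g := fun i q g => by
    have hqg : π (q <• g) = π q := congrArg Prod.snd (R.proj_act q g)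
    by_cases h : π q ∈ Function.support (ρ i)
    · have hU' := hρU i (subset_tsupport _ h)
      rw [hKU i q hU', hKU i _ (hqg ▸ hU')]
      simp only [L, hqg, R.proj_act]
      rw [R.toPrincipalBundle.div_act_right (hpσ i q hU'), MulOpposite.op_mul, mul_smul]
    · rw [hK i q h, hK i _ (by rwa [hqg])]
  have hKψ : ∀ i q, R.ψ (K i q) = R.ψ q := fun i q => by
    by_cases h : π q ∈ Function.support (ρ i)
    · have hU' := hρU i (subset_tsupport _ h)
      rw [hKU i q hU', R.ψ_act, (hσ i).ψ_eq _ (mem_univ _) (R.proj q).1 (mem_univ _) _ hU',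
        ← R.ψ_act]
      exact congrArg R.ψ (hσdiv i q hU')
    · rw [hK i q h]
  refine ⟨⟨orderedComp hS π K, continuous_orderedComp hπc hπ hK hKc⟩, fun q => ?_, fun q g => ?_,
    fun q => ?_⟩
  · obtain ⟨i, hi⟩ := hρ1 (π q)
    refine Prod.ext ?_ ?_
    -- A factor with $\rho_i=1$ brings the time to $1$, and no factor lowers it. The second argument
    -- of the relations is a dummy.
    · refine orderedComp_improve (q := fun a _ => π a = π q) (r := fun a _ => (R.proj a).1 = 1)
        (z' := q) rfl (i := i) ?_ rfl (fun j z _ h => (hπ j z).trans h) (fun z _ h => ?_)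
        (fun j z _ h => ?_)
      · change ρ i (π q) ≠ 0
        rw [hi]
        exact one_ne_zero
      · rw [hKproj, h, hi]
        exact sup_eq_right.2 unitInterval.le_one'
      · rw [hKproj, h]
        exact sup_eq_left.2 unitInterval.le_one'
    · exact orderedComp_induction (p := fun a => π a = π q) rfl fun j z h => (hπ j z).trans h
  · refine orderedComp_induction₂ (q := fun a b => a = b <• g) (congrArg Prod.snd (R.proj_act q g))
      rfl ?_
    rintro j _ z rfl
    exact hKact j z g
  · exact orderedComp_induction (p := fun a => R.ψ a = R.ψ q) rfl fun j z h => (hKψ j z).trans h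

end Bibundle

end

/-! ### Homotopy classes over a base -/

section

variable {M Y B : Type u} [TopologicalSpace M] [TopologicalSpace Y] [TopologicalSpace B]
  (q : C(Y, B))

/-- Puts classes whose underlying maps to `B` are only propositionally equal into one fibre of the
sigma type. -/
theorem homotopyClassOver_eq_mk {f : C(M, Y)} {p : C(M, B)} (e : q.comp f = p) :
    homotopyClassOver q f = ⟨p, Quotient.mk (MapsOver.setoid p q) ⟨f, e⟩⟩ := by
  subst e
  rfl

theorem homotopyClassOver_surjective :
    Function.Surjective (homotopyClassOver q : C(M, Y) → AllHomotopyClassesOver M q) := by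
  rintro ⟨p, c⟩
  obtain ⟨⟨f, e⟩, rfl⟩ := Quotient.exists_rep c
  exact ⟨f, homotopyClassOver_eq_mk q e⟩

theorem homotopyClassOver_eq_iff {f g : C(M, Y)} :
    homotopyClassOver q f = homotopyClassOver q g ↔
      ∃ h : f.Homotopy g, ∀ (s : unitInterval) (x : M), q (h (s, x)) = q (f x) := by
  constructor
  · intro hfg
    have e : q.comp g = q.comp f := (congrArg Sigma.fst hfg).symm
    rw [homotopyClassOver_eq_mk q e] at hfg
    exact Quotient.exact (s := MapsOver.setoid (q.comp f) q) (eq_of_heq (Sigma.mk.inj hfg).2)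
  · rintro ⟨h, hh⟩
    have e : q.comp g = q.comp f := by
      ext x
      have := hh 1 x
      rwa [h.apply_one] at this
    rw [homotopyClassOver_eq_mk q e]
    exact congrArg (Sigma.mk (q.comp f))
      (Quotient.sound (s := MapsOver.setoid (q.comp f) q) ⟨h, hh⟩)

end

/-! ### Classifying maps and pullbacks -/

namespace Bibundle

section

variable {G H : Type u} [Group G] [TopologicalSpace G] [Group H] [TopologicalSpace H]
  {X : TopCrossedModule G H} {M : Type u} [TopologicalSpace M]
  {BG : Type u} [TopologicalSpace BG]

/-- The map `Γ : M → EG ×_G H` is induced by the equivariant map `f : P → EG` and the structure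
map of the bibundle `P`. -/
structure IsClassifiedBy (P : Bibundle X M) (E : PrincipalBundle G BG) (f : C(P.Total, E.Total))
    (Γ : C(M, E.Assoc X)) : Prop where
  map_act : ∀ (p : P.Total) (g : G), f (p <• g) = f p <• g
  apply_proj : ∀ p : P.Total, Γ (P.proj p) = E.assocMk X (f p) (P.ψ p)

theorem exists_isClassifiedBy (P : Bibundle X M) (E : PrincipalBundle G BG)
    (f : C(P.Total, E.Total)) (hf : ∀ (p : P.Total) (g : G), f (p <• g) = f p <• g) :
    ∃ Γ, P.IsClassifiedBy E f Γ := by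
  have hq := P.toPrincipalBundle.isOpenQuotientMap_proj.isQuotientMap
  let F : C(P.Total, E.Assoc X) := ⟨fun p => E.assocMk X (f p) (P.ψ p),
    (E.isQuotientMap_assocMk X).continuous.comp (f.continuous.prodMk P.ψ.continuous)⟩
  have hF : ∀ p p', P.proj p = P.proj p' → F p = F p' := fun p p' h => by
    obtain ⟨g, rfl⟩ := P.toPrincipalBundle.exists_act_eq h
    change _ = E.assocMk X (f (p <• g)) (P.ψ (p <• g))
    rw [hf, P.ψ_act, E.assocMk_act]
    rfl
  exact ⟨hq.lift (f := P.proj) F hF, hf,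
    fun p => DFunLike.congr_fun (hq.lift_comp (f := P.proj) F hF) p⟩

/-- Only the $EG$-component moves, through an equivariant homotopy $h_s$. Hence $[h_s(p),\psi(p)]$
descends to $M$, and its image $[\psi(p)]$ under $\Phi$ is constant. -/
theorem IsClassifiedBy.homotopyClassOver_eq [IsTopologicalGroup G] [T2Space M] [ParacompactSpace M]
    {P : Bibundle X M} {E : PrincipalBundle G BG} (hE : E.IsUniversal)
    {f₀ f₁ : C(P.Total, E.Total)} {Γ₀ Γ₁ : C(M, E.Assoc X)} (h₀ : P.IsClassifiedBy E f₀ Γ₀)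
    (h₁ : P.IsClassifiedBy E f₁ Γ₁) :
    homotopyClassOver (E.assocType X) Γ₀ = homotopyClassOver (E.assocType X) Γ₁ := by
  have : ContractibleSpace E.Total := hE
  obtain ⟨h, hh⟩ :=
    P.toPrincipalBundle.exists_equivariant_homotopy f₀ f₁ h₀.map_act h₁.map_act
  have hproj := P.toPrincipalBundle.isOpenQuotientMap_proj
  have hq := (IsOpenQuotientMap.id (X := unitInterval)).prodMap hproj |>.isQuotientMap
  let F : C(unitInterval × P.Total, E.Assoc X) := ⟨fun z => E.assocMk X (h z) (P.ψ z.2),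
    (E.isQuotientMap_assocMk X).continuous.comp
      (h.continuous.prodMk (P.ψ.continuous.comp continuous_snd))⟩
  let π : C(unitInterval × P.Total, unitInterval × M) := ⟨Prod.map id P.proj, hq.continuous⟩
  have hF : ∀ z z', π z = π z' → F z = F z' := by
    rintro ⟨s, p⟩ ⟨s', p'⟩ e
    obtain ⟨e₁, e₂⟩ := Prod.mk.inj e
    obtain rfl : s = s' := e₁
    obtain ⟨g, rfl⟩ := P.toPrincipalBundle.exists_act_eq e₂
    change _ = E.assocMk X (h (s, p <• g)) (P.ψ (p <• g))
    rw [hh, P.ψ_act, E.assocMk_act]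
    rfl
  let k : C(unitInterval × M, E.Assoc X) := hq.lift (f := π) F hF
  have hk : ∀ s p, k (s, P.proj p) = E.assocMk X (h (s, p)) (P.ψ p) := fun s p =>
    DFunLike.congr_fun (hq.lift_comp (f := π) F hF) (s, p)
  refine (homotopyClassOver_eq_iff _).2 ⟨⟨k, fun x => ?_, fun x => ?_⟩, fun s x => ?_⟩
  · obtain ⟨p, rfl⟩ := hproj.surjective x
    exact (hk 0 p).trans (by rw [h.apply_zero, h₀.apply_proj])
  · obtain ⟨p, rfl⟩ := hproj.surjective x
    exact (hk 1 p).trans (by rw [h.apply_one, h₁.apply_proj])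
  · obtain ⟨p, rfl⟩ := hproj.surjective x
    change E.assocType X (k (s, P.proj p)) = _
    rw [hk, h₀.apply_proj]
    rfl

theorem IsClassifiedBy.of_isomorphic {P Q : Bibundle X M} {E : PrincipalBundle G BG}
    (hPQ : P.Isomorphic Q) {f : C(Q.Total, E.Total)} {Γ : C(M, E.Assoc X)}
    (h : Q.IsClassifiedBy E f Γ) : ∃ f', P.IsClassifiedBy E f' Γ := by
  obtain ⟨e, h1, h2, h3⟩ := hPQ
  refine ⟨⟨fun p => f (e p), by fun_prop⟩, fun p g => ?_, fun p => ?_⟩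
  · change f (e (p <• g)) = f (e p) <• g
    rw [h2, h.map_act]
  · rw [← h1, h.apply_proj, h3]
    rfl

theorem isClassifiedBy_pullback_assocBibundle [IsTopologicalGroup G] [IsTopologicalGroup H]
    (E : PrincipalBundle G BG) (Γ : C(M, E.Assoc X)) :
    ((E.assocBibundle X).pullback Γ).IsClassifiedBy E
      ⟨fun x => (Prod.fst : E.Total × H → E.Total) x.1.2,
        (continuous_fst (X := E.Total) (Y := H)).comp
          (continuous_snd.comp continuous_subtype_val)⟩ Γ where
  map_act _ _ := rfl
  apply_proj p := p.2

theorem IsClassifiedBy.isomorphic_pullback [IsTopologicalGroup G] [IsTopologicalGroup H]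
    {P : Bibundle X M} {E : PrincipalBundle G BG} {f : C(P.Total, E.Total)}
    {Γ : C(M, E.Assoc X)} (h : P.IsClassifiedBy E f Γ) :
    P.Isomorphic ((E.assocBibundle X).pullback Γ) := by
  let Q := (E.assocBibundle X).pullback Γ
  let e : C(P.Total, Q.Total) :=
    ⟨fun p => ⟨(P.proj p, ((f p, P.ψ p) : E.Total × H)), h.apply_proj p⟩,
      Continuous.subtype_mk
        (P.proj.continuous.prodMk (f.continuous.prodMk P.ψ.continuous)) _⟩
  obtain ⟨e', he'⟩ := P.toPrincipalBundle.exists_homeomorph Q.toPrincipalBundle e (fun p => rfl)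
    fun p g => Subtype.ext (Prod.ext (P.proj_act p g) (Prod.ext (h.map_act p g) (P.ψ_act p g)))
  refine ⟨e', fun p => ?_, fun p g => ?_, fun p => ?_⟩
  · rw [he']
    rfl
  · rw [he', he']
    exact Subtype.ext (Prod.ext (P.proj_act p g) (Prod.ext (h.map_act p g) (P.ψ_act p g)))
  · rw [he']
    rfl

/-- Pullbacks of a bibundle along homotopic maps are isomorphic if the type is constant along the
homotopy. -/
theorem pullback_isomorphic_of_homotopy [IsTopologicalGroup G] [IsTopologicalGroup H] [T2Space M]
    [ParacompactSpace M] (hG : HasLocalSections X.t.toMonoidHom.rangeRestrict) {N : Type u}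
    [TopologicalSpace N] (P : Bibundle X N) {f₀ f₁ : C(M, N)} (h : f₀.Homotopy f₁)
    (hP : ∀ s s' x (p p' : P.Total), P.proj p = h (s, x) → P.proj p' = h (s', x) →
      (QuotientGroup.mk (P.ψ p) : H ⧸ X.tG) = QuotientGroup.mk (P.ψ p')) :
    (P.pullback f₀).Isomorphic (P.pullback f₁) := by
  -- The two pullbacks are the restrictions of `R` to times $0$ and $1$, and transport in `R`
  -- carries the first to the second.
  let R := P.pullback h.toContinuousMap
  have hR : R.HasConstantType := by
    rintro ⟨⟨⟨s, x⟩, p⟩, e⟩ ⟨⟨⟨s', x'⟩, p'⟩, e'⟩ hx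
    obtain rfl : x = x' := hx
    exact hP s s' x p p' e.symm e'.symm
  obtain ⟨T, hT, hTact, hTψ⟩ := hR.exists_transport hG
  let Q₀ := P.pullback f₀
  let Q₁ := P.pullback f₁
  let j : C(Q₀.Total, R.Total) :=
    ⟨fun x => ⟨((0, x.1.1), x.1.2), (h.apply_zero x.1.1).trans x.2⟩, by
      refine Continuous.subtype_mk ?_ _
      exact (continuous_const.prodMk (continuous_fst.comp continuous_subtype_val)).prodMk
        (continuous_snd.comp continuous_subtype_val)⟩
  let e : C(Q₀.Total, Q₁.Total) :=
    ⟨fun x => ⟨(x.1.1, (T (j x)).1.2), by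
      have h1 : h.toContinuousMap (R.proj (T (j x))) = P.proj (T (j x)).1.2 := (T (j x)).2
      rw [hT] at h1
      exact (h.apply_one x.1.1).symm.trans h1⟩, by
      refine Continuous.subtype_mk ?_ _
      exact (continuous_fst.comp continuous_subtype_val).prodMk
        (continuous_snd.comp (continuous_subtype_val.comp (T.continuous.comp j.continuous)))⟩
  have he : ∀ (x : Q₀.Total) (g : G), e (x <• g) = e x <• g := fun x g => by
    refine Subtype.ext (Prod.ext rfl ?_)
    change (T (j x <• g)).1.2 = _
    rw [hTact]
    rfl
  obtain ⟨e', he'⟩ := Q₀.toPrincipalBundle.exists_homeomorph Q₁.toPrincipalBundle e (fun p => rfl) he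
  refine ⟨e', fun p => ?_, fun p g => ?_, fun p => ?_⟩
  · rw [he']
    rfl
  · rw [he', he', he]
  · rw [he']
    exact hTψ (j p)

theorem pullback_assocBibundle_isomorphic [IsTopologicalGroup G] [IsTopologicalGroup H]
    [T2Space M] [ParacompactSpace M] (hG : HasLocalSections X.t.toMonoidHom.rangeRestrict)
    (E : PrincipalBundle G BG) {Γ₀ Γ₁ : C(M, E.Assoc X)}
    (h : homotopyClassOver (E.assocType X) Γ₀ = homotopyClassOver (E.assocType X) Γ₁) :
    ((E.assocBibundle X).pullback Γ₀).Isomorphic ((E.assocBibundle X).pullback Γ₁) := by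
  obtain ⟨h, hh⟩ := (homotopyClassOver_eq_iff _).1 h
  refine pullback_isomorphic_of_homotopy hG _ h fun s s' x p p' e e' => ?_
  have key : ∀ s (p : (E.assocBibundle X).Total), (E.assocBibundle X).proj p = h (s, x) →
      (QuotientGroup.mk ((E.assocBibundle X).ψ p) : H ⧸ X.tG) = E.assocType X (Γ₀ x) :=
    fun s p e => by
      rw [← hh s x, ← e]
      rfl
  rw [key s p e, key s' p' e']

end

end Bibundle

end

/-! ### The classification theorem -/

theorem mainTheorem2 {G H : Type u} [Group G] [TopologicalSpace G] [IsTopologicalGroup G]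
    [Group H] [TopologicalSpace H] [IsTopologicalGroup H]
    (X : TopCrossedModule G H)
    (hG : HasLocalSections X.t.toMonoidHom.rangeRestrict)
    (hH : HasLocalSections (QuotientGroup.mk : H → H ⧸ X.tG))
    {BG : Type u} [TopologicalSpace BG] (E : PrincipalBundle G BG) (hE : E.IsUniversal)
    (M : Type u) [TopologicalSpace M] [T2Space M] [ParacompactSpace M] :
    -- every bibundle `P` has a continuous equivariant map `P → EG`
    (∀ P : Bibundle X M, ∃ fhat : C(P.Total, E.Total),
      ∀ (p : P.Total) (g : G), fhat (p <• g) = fhat p <• g) ∧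
    ∃ Θ : Pi0Bibun X M ≃ AllHomotopyClassesOver M (E.assocType X),
      -- `Θ [P]` is the class of `Γ`, for every choice of the equivariant map `P → EG`
      (∀ (P : Bibundle X M) (fhat : C(P.Total, E.Total)),
        (∀ (p : P.Total) (g : G), fhat (p <• g) = fhat p <• g) →
        ∃ Γ : C(M, E.Assoc X),
          (∀ p : P.Total, Γ (P.proj p) = E.assocMk X (fhat p) (P.ψ p)) ∧
          Θ P.isoClass = homotopyClassOver (E.assocType X) Γ) ∧
      -- the map to `H/t(G)` underlying `Θ [P]` is the type map of `P`
      (∀ (P : Bibundle X M) (p : P.Total),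
        (Θ P.isoClass).1 (P.proj p) = QuotientGroup.mk (P.ψ p)) ∧
      -- the inverse of `Θ` is the pullback of the bibundle `EG × H → EG ×_G H`
      (∀ f : C(M, E.Assoc X),
        Θ.symm (homotopyClassOver (E.assocType X) f) =
          ((E.assocBibundle X).pullback f).isoClass) := by
  have : ContractibleSpace E.Total := hE
  have hmap : ∀ P : Bibundle X M, ∃ fhat : C(P.Total, E.Total),
      ∀ (p : P.Total) (g : G), fhat (p <• g) = fhat p <• g := fun P =>
    P.toPrincipalBundle.exists_equivariant_map
  have hΓ : ∀ P : Bibundle X M, ∃ Γ f, P.IsClassifiedBy E f Γ := fun P => by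
    obtain ⟨f, hf⟩ := hmap P
    obtain ⟨Γ, h⟩ := P.exists_isClassifiedBy E f hf
    exact ⟨Γ, f, h⟩
  choose Γ f hf using hΓ
  let Θ : Pi0Bibun X M → AllHomotopyClassesOver M (E.assocType X) :=
    Quotient.lift (s := Bibundle.setoid X M)
      (fun P => homotopyClassOver (E.assocType X) (Γ P)) fun P Q hPQ => by
        -- Through the isomorphism, the chosen map for `Q` also classifies `P`, so independence of
        -- the choice of $\hat f$ for `P` settles well-definedness.
        obtain ⟨f', hf'⟩ := (hf Q).of_isomorphic hPQ
        exact (hf P).homotopyClassOver_eq hE hf'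
  have hΘ : ∀ (P : Bibundle X M) (fhat : C(P.Total, E.Total)) (Γ' : C(M, E.Assoc X)),
      P.IsClassifiedBy E fhat Γ' →
        Θ P.isoClass = homotopyClassOver (E.assocType X) Γ' := fun P fhat Γ' h =>
    (hf P).homotopyClassOver_eq hE h
  have hpull : ∀ Γ' : C(M, E.Assoc X), Θ ((E.assocBibundle X).pullback Γ').isoClass =
      homotopyClassOver (E.assocType X) Γ' := fun Γ' =>
    hΘ _ _ Γ' (Bibundle.isClassifiedBy_pullback_assocBibundle E Γ')
  have hbij : Function.Bijective Θ := by
    constructor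
    · intro a b hab
      obtain ⟨P, rfl⟩ := Quotient.exists_rep a
      obtain ⟨Q, rfl⟩ := Quotient.exists_rep b
      refine Quotient.sound (s := Bibundle.setoid X M) ?_
      have h1 := (hf P).isomorphic_pullback
      have h2 := (hf Q).isomorphic_pullback
      have h3 := Bibundle.pullback_assocBibundle_isomorphic hG E hab
      exact (Bibundle.setoid X M).trans h1
        ((Bibundle.setoid X M).trans h3 ((Bibundle.setoid X M).symm h2))
    · intro c
      obtain ⟨Γ', rfl⟩ := homotopyClassOver_surjective _ c
      exact ⟨_, hpull Γ'⟩
  refine ⟨hmap, Equiv.ofBijective Θ hbij, fun P fhat hfhat => ?_, fun P p => ?_, fun Γ' => ?_⟩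
  · obtain ⟨Γ', h⟩ := P.exists_isClassifiedBy E fhat hfhat
    exact ⟨Γ', h.apply_proj, hΘ P fhat Γ' h⟩
  · change E.assocType X (Γ P (P.proj p)) = _
    rw [(hf P).apply_proj]
    rfl
  · rw [Equiv.symm_apply_eq]
    exact (hpull Γ').symm
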